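/- Let $\mathbb F$ be an arbitrary field and let $t$, $n_1,\dots,n_t$, $m_1,\dots,m_t$ be positive integers with $n_i\le m_i$ for all $i$ and $m_1\ge\cdots\ge m_t$. Put $N=n_1+\cdots+n_t$ and $\Pi=\bigoplus_{i=1}^t\mathbb F^{n_i\times m_i}$, and for $X=(X_1,\dots,X_t)\in\Pi$ let $\mathrm{srk}(X)=\sum_{i=1}^t\mathrm{rk}(X_i)$. For an integer $0\le r\le N$, an $r$-anticode is a non-empty set $A\subseteq\Pi$ with $\mathrm{srk}(X-Y)\le r$ for all $X,Y\in A$; it is linear if it is an $\mathbb F$-subspace of $\Pi$. A linear anticode $A\le\Pi$ is called optimal if, for some $0\le r\le N$, it is an $r$-anticode and $$\dim_{\mathbb F} A=\max\Big\{\sum_{i=1}^t m_iu_i \;\Big|\; u_i\in\mathbb Z,\ 0\le u_i\le n_i \text{ for all } i,\ \sum_{i=1}^t u_i=r\Big\}.$$ In the case of one block this reads as follows: for $1\le n\le m$, a subspace $B\le\mathbb F^{n\times m}$ is an optimal linear rank-metric anticode if, for some $0\le r\le n$, one has $\mathrm{rk}(X-Y)\le r$ for all $X,Y\in B$ and $\dim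 B=mr$. In the case of $k$ blocks of size $1\times1$ it reads: a subspace $H\le\mathbb F^{k}$ is an optimal linear Hamming-metric anticode if, for some $0\le r\le k$, any two elements of $H$ have Hamming distance at most $r$ and $\dim H=r$ (for $k=0$, the space $H=\{0\}$ is optimal). **Theorem.** Let $0\le s\le t$ be such that $m_i>1$ for $i\le s$ and $m_i=1$ (hence $n_i=1$) for $i>s$, and let $A\le\Pi$ be an optimal linear anticode. Then $$A=A_1\oplus\cdots\oplus A_s\oplus A^{\mathsf h},$$ where $A_i\le\mathbb F^{n_i\times m_i}$ is an optimal linear rank-metric anticode for each $i\in\{1,\dots,s\}$, and $A^{\mathsf h}$ is an optimal linear Hamming-metric anticode in $\bigoplus_{i=s+1}^t\mathbb F^{1\times1}=\mathbb F^{t-s}$. If moreover $|\mathbb F|\ge3$, then $A^{\mathsf h}=A^{\mathsf h}_1\oplus\cdots\oplus A^{\mathsf h}_{t-s}$, where each $A^{\mathsf h}_j\in\{\mathbb F,\{0\}\}$ and $A^{\mathsf h}_j$ lies in the $j$-th coordinate. -/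

import Mathlib

namespace SumRank

/-- The sum-rank metric space `F^{n_1 × m_1} ⊕ ⋯ ⊕ F^{n_t × m_t}`: tuples of matrices, the
`i`-th one of size `n i × m i`. -/
abbrev Space (F : Type*) {t : ℕ} (n m : Fin t → ℕ) : Type _ :=
  (i : Fin t) → Matrix (Fin (n i)) (Fin (m i)) F

/-- The sum-rank of a tuple of matrices. -/
noncomputable def srk {F : Type*} [Field F] {t : ℕ} {n m : Fin t → ℕ} (X : Space F n m) : ℕ :=
  ∑ i, (X i).rank

/-- `A` is a (sum-rank metric) `r`-anticode, `0 ≤ r ≤ N = n_1 + ⋯ + n_t`. -/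
def IsAnticode {F : Type*} [Field F] {t : ℕ} {n m : Fin t → ℕ} (r : ℕ)
    (A : Set (Space F n m)) : Prop :=
  r ≤ ∑ i, n i ∧ A.Nonempty ∧ ∀ X ∈ A, ∀ Y ∈ A, srk (X - Y) ≤ r

/-- The set `U_r` of all `(u_1, …, u_t)` with `0 ≤ u_i ≤ n_i` and `u_1 + ⋯ + u_t = r`. -/
def profiles {t : ℕ} (n : Fin t → ℕ) (r : ℕ) : Set (Fin t → ℕ) :=
  {u | (∀ i, u i ≤ n i) ∧ ∑ i, u i = r}

/-- The linear sum-rank anticode `A` is optimal: for some `r` it is an `r`-anticode whose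
dimension equals `max {∑ i, m_i u_i | u ∈ U_r}`. -/
def IsOptimalLinearAnticode {F : Type*} [Field F] {t : ℕ} {n m : Fin t → ℕ}
    (A : Submodule F (Space F n m)) : Prop :=
  ∃ r : ℕ, IsAnticode r (A : Set (Space F n m)) ∧
    IsGreatest ((fun u : Fin t → ℕ => ∑ i, m i * u i) '' profiles n r) (Module.finrank F A)

/-- Optimal linear anticodes for the rank metric on `F^{n × m}` (used for `n ≤ m`), the case of
one block: for some `0 ≤ r ≤ n`, all distances in `A` are at most `r`, and `dim A = m r`. -/
def IsOptimalLinearRankAnticode {F : Type*} [Field F] {n m : ℕ}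
    (A : Submodule F (Matrix (Fin n) (Fin m) F)) : Prop :=
  ∃ r : ℕ, r ≤ n ∧ (∀ X ∈ A, ∀ Y ∈ A, (X - Y).rank ≤ r) ∧ Module.finrank F A = m * r

open Classical in
/-- Optimal linear anticodes for the Hamming metric on `F^k`, the case of `k` blocks of size
`1 × 1`: for some `0 ≤ r ≤ k`, all Hamming distances in `A` are at most `r`, and `dim A = r`. -/
def IsOptimalLinearHammingAnticode {F : Type*} [Field F] {k : ℕ}
    (A : Submodule F (Fin k → F)) : Prop :=
  ∃ r : ℕ, r ≤ k ∧ (∀ x ∈ A, ∀ y ∈ A, hammingDist x y ≤ r) ∧ Module.finrank F A = r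

/-- The `i`-th of the first `s` indices. -/
def headIdx {t s : ℕ} (hs : s ≤ t) (i : Fin s) : Fin t := Fin.castLE hs i

/-- The `j`-th of the last `t - s` indices. -/
def tailIdx {t s : ℕ} (j : Fin (t - s)) : Fin t :=
  ⟨s + j.1, Nat.add_lt_of_lt_sub' j.2⟩

/-- The vector in `F^{t-s}` that lists the upper left entries of the last `t - s` blocks of a tuple
(where these blocks have size `1 × 1`, this is the identification of
`F^{n_{s+1} × m_{s+1}} ⊕ ⋯ ⊕ F^{n_t × m_t}` with `F^{t-s}`). -/
def tailVec {F : Type*} {t : ℕ} {n m : Fin t → ℕ} (hn : ∀ i, 0 < n i) (hm : ∀ i, 0 < m i)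
    (s : ℕ) (X : Space F n m) : Fin (t - s) → F :=
  fun j => X (tailIdx j) ⟨0, hn _⟩ ⟨0, hm _⟩

end SumRank

/-!
# The structure of optimal linear anticodes in the sum-rank metric

Let `A` be an optimal linear `r`-anticode. Read the cells of a tuple of matrices block by block and
row by row. An element of `A` that vanishes on all leading cells of elements of `A` is zero, so there
are at least `dim A` leading cells (`eq_zero_of_leadingCells`). If leading cells lie in different
rows and columns (a placement of non-attacking rooks), then `A` contains an element whose rows
through these cells are independent in each block, so there are at most `r` of them
(`sum_rookCount_leadingCells_le`). This holds over every field: the element is built one row at a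
time, and each step needs only one of the coefficients `0` and `1`
(`exists_linearIndependent_update_add_smul`).

An `n × m` board with `n ≤ m` is a disjoint union of `m` full rook placements. Hence a block in
which at most `ν` leading cells lie on a placement has at most `m ν` leading cells. As `dim A` is
maximal, equality holds in each block, and all placements meet the leading cells of a block equally
often. Then these cells form full rows or, when `n = m`, full columns
(`mem_iff_mem_of_rookCount_eq_of_lt`, `rows_or_columns_of_rookCount_eq`). After transposing some
square blocks, `A` is the graph of a linear map: the rows in a set of `r` rows are arbitrary and
determine the others (`IsFrame`, `exists_isFrame`).

If the `r` chosen rows are independent in each block, then they span the row space of each block,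
since the sum-rank is at most `r`. Changing a chosen row of one block, while those of another
block `j` stay fixed, thus changes each further row of block `j` by a vector in the span of the
chosen rows of block `j`; these can be any independent rows, so the change is zero
(`IsFrame.apply_eq_zero_of_ne`). The argument needs two independent families that differ in one row
by a given vector. They exist unless `|F| = 2` and the block changed is `1 × 1`; if such a block
has a chosen row, then maximality of `dim A` ensures that all rows of wider blocks are chosen. So all
blocks of width at least two split off, and all blocks do if `|F| ≥ 3` (`IsFrame.single_mem`).
Counting the chosen rows shows that the summands are optimal.
-/

namespace SumRank

/-! ### Independent families and rows -/

section LinearIndependence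

variable {F V E κ : Type*} [Field F] [AddCommGroup V] [Module F V] [AddCommGroup E] [Module F E]

/-- A family that is triangular with respect to some linear functionals is independent. -/
lemma linearIndependent_of_triangular {Λ : Type*} [LinearOrder Λ] (v : κ → V)
    (l : κ → V →ₗ[F] F) (key : κ → Λ) (hkey : Function.Injective key)
    (hdiag : ∀ a, l a (v a) ≠ 0) (hlow : ∀ a b, key b < key a → l b (v a) = 0) :
    LinearIndependent F v := by
  classical
  rw [linearIndependent_iff']
  intro S g hg
  by_contra! hne
  obtain ⟨a, haS, hga, hmin⟩ : ∃ a ∈ S, g a ≠ 0 ∧ ∀ b ∈ S, g b ≠ 0 → key a ≤ key b := by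
    obtain ⟨i, hi, hi0⟩ := hne
    obtain ⟨a, ha, hmin⟩ := (S.filter (g · ≠ 0)).exists_min_image key
      ⟨i, by simp [hi, hi0]⟩
    simp only [Finset.mem_filter] at ha hmin
    exact ⟨a, ha.1, ha.2, fun b hb hb0 => hmin b ⟨hb, hb0⟩⟩
  have h : ∑ b ∈ S, g b * l a (v b) = 0 := by
    simpa using congrArg (l a) hg
  rw [Finset.sum_eq_single_of_mem a haS] at h
  · exact (mul_ne_zero hga (hdiag a)) h
  · intro b hb hba
    by_cases hb0 : g b = 0
    · simp [hb0]
    · rw [hlow b a (lt_of_le_of_ne (hmin b hb hb0) fun h => hba (hkey h).symm), mul_zero]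

lemma linearIndependent_update_iff [DecidableEq κ] {v : κ → V} (hv : LinearIndependent F v)
    (a : κ) (w : V) :
    LinearIndependent F (Function.update v a w) ↔ w ∉ Submodule.span F (v '' {a}ᶜ) := by
  have hEq : Set.EqOn (Function.update v a w) v {a}ᶜ := fun b hb => by
    simp [Function.update_of_ne (show b ≠ a from hb)]
  have huniv : (Set.univ : Set κ) = insert a {a}ᶜ := by
    ext b
    simp [eq_or_ne]
  rw [← linearIndepOn_univ_iff, huniv, linearIndepOn_insert (by simp),
    linearIndepOn_congr hEq, Function.update_self, hEq.image_eq]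
  exact and_iff_right (hv.linearIndepOn _)

/-- Replacing a member `v a` of an independent family by either `w` or `w + v a` keeps the family
independent, whatever `w` is.  That the coefficients `0` and `1` suffice is what makes the argument
work over every field. -/
lemma exists_linearIndependent_update_add_smul [DecidableEq κ] {v : κ → V}
    (hv : LinearIndependent F v) (a : κ) (w : V) :
    ∃ c : F, LinearIndependent F (Function.update v a (w + c • v a)) := by
  by_contra! h
  have h0 := h 0
  have h1 := h 1
  rw [linearIndependent_update_iff hv, not_not] at h0 h1
  have hva : v a ∈ Submodule.span F (v '' {a}ᶜ) := by
    have := Submodule.sub_mem _ h1 h0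
    simpa using this
  have := (linearIndependent_update_iff hv a (v a)).1 (by simpa using hv)
  exact this hva

/-- Let `R l`, `l : κ`, be linear maps and let `x l` be vectors in `A` such that the `R l (x l)` are
independent, while `R l` kills every `x a` with a larger key.  Then a single vector of `A` has
independent images under the `R l`. -/
lemma exists_linearIndependent_apply [Finite κ] {Λ : Type*} [LinearOrder Λ] (A : Submodule F E)
    (R : κ → E →ₗ[F] V) (x : κ → E) (hx : ∀ l, x l ∈ A) (key : κ → Λ)
    (hlow : ∀ l a, l ≠ a → key l ≤ key a → R l (x a) = 0)
    (hind : LinearIndependent F fun l => R l (x l)) :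
    ∃ X ∈ A, LinearIndependent F fun l => R l X := by
  classical
  cases nonempty_fintype κ
  -- the members indexed by a growing set `D` of small keys are taken from the common vector `X`
  suffices h : ∀ D : Finset κ, ∃ X ∈ A,
      LinearIndependent F fun l => if l ∈ D then R l X else R l (x l) by
    simpa using h Finset.univ
  intro D
  induction D using Finset.induction_on_max_value key with
  | empty => exact ⟨0, A.zero_mem, by simpa using hind⟩
  | insert a D haD hmax ih =>
    obtain ⟨X, hXA, hX⟩ := ih
    obtain ⟨c, hc⟩ := exists_linearIndependent_update_add_smul hX a (R a X)
    refine ⟨X + c • x a, A.add_mem hXA (A.smul_mem c (hx a)), ?_⟩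
    convert hc using 1
    funext l
    by_cases hla : l = a
    · subst hla
      simp [haD]
    · by_cases hlD : l ∈ D
      · simp [hla, hlD, hlow l a hla (hmax l hlD)]
      · simp [hla, hlD]

/-- In `F^m`, a nonzero vector is a prescribed member of some independent family of at most `m`
vectors. -/
lemma exists_linearIndependent_apply_eq [Finite κ] {m : ℕ} (hκ : Nat.card κ ≤ m) (o : κ)
    {v : Fin m → F} (hv : v ≠ 0) :
    ∃ w : κ → Fin m → F, LinearIndependent F w ∧ w o = v := by
  classical
  cases nonempty_fintype κ
  obtain ⟨e⟩ : Nonempty (κ ↪ Fin m) :=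
    Function.Embedding.nonempty_of_card_le (by simpa [Nat.card_eq_fintype_card] using hκ)
  set u : κ → Fin m → F := fun a => Pi.single (e a) 1 with hu
  have hind : LinearIndependent F u := (Pi.linearIndependent_single_one (Fin m) F).comp e e.injective
  have huo : u o ≠ 0 := hind.ne_zero o
  obtain ⟨g, hg⟩ := Submodule.exists_linearEquiv_restrict_eq
    ((LinearEquiv.toSpanNonzeroSingleton F _ (u o) huo).symm.trans
      (LinearEquiv.toSpanNonzeroSingleton F _ v hv))
  refine ⟨fun a => g (u a), hind.map' g.toLinearMap g.ker, ?_⟩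
  have h := hg ⟨u o, Submodule.mem_span_singleton_self _⟩
  change g (u o) = v
  rw [← h]
  have h1 := LinearEquiv.coord_self F (Fin m → F) (u o) huo
  simp only [LinearEquiv.coord] at h1
  simp [h1]

lemma exists_linearIndependent_fin [Finite κ] {m : ℕ} (hκ : Nat.card κ ≤ m) :
    ∃ w : κ → Fin m → F, LinearIndependent F w := by
  classical
  cases nonempty_fintype κ
  obtain ⟨e⟩ : Nonempty (κ ↪ Fin m) :=
    Function.Embedding.nonempty_of_card_le (by simpa [Nat.card_eq_fintype_card] using hκ)
  exact ⟨_, (Pi.linearIndependent_single_one (Fin m) F).comp e e.injective⟩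

/-- A vector that lies in the span of every independent family of `k < m` vectors of `F^m`
vanishes. -/
lemma eq_zero_of_forall_mem_span [Finite κ] {m : ℕ} (hκ : Nat.card κ < m) {u : Fin m → F}
    (hu : ∀ w : κ → Fin m → F, LinearIndependent F w → u ∈ Submodule.span F (Set.range w)) :
    u = 0 := by
  by_contra hne
  cases nonempty_fintype κ
  obtain ⟨w, hw, hwu⟩ := exists_linearIndependent_apply_eq (κ := Option κ) (F := F) (m := m)
    (by simpa [Nat.card_eq_fintype_card] using hκ) none hne
  rw [linearIndependent_option] at hw
  exact hw.2 (hwu ▸ hu _ hw.1)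

/-- Every vector `v` of `F^m` is the difference of the `l`-th members of two independent families
that agree elsewhere, except when `F` has two elements and `m = 1`: there `1` is the only nonzero
vector. -/
lemma exists_linearIndependent_add_single [DecidableEq κ] [Finite κ] {m : ℕ} (hκ : Nat.card κ ≤ m)
    (h : 2 ≤ m ∨ 3 ≤ ENat.card F) (l : κ) (v : Fin m → F) :
    ∃ w : κ → Fin m → F, LinearIndependent F w ∧ LinearIndependent F (w + Pi.single l v) := by
  cases nonempty_fintype κ
  rcases eq_or_ne v 0 with rfl | hv
  · obtain ⟨w, hw⟩ := exists_linearIndependent_fin (F := F) hκ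
    exact ⟨w, hw, by simpa using hw⟩
  have key : ∀ {w : κ → Fin m → F}, LinearIndependent F w →
      w l + v ∉ Submodule.span F (w '' {l}ᶜ) → LinearIndependent F (w + Pi.single l v) := by
    intro w hw hwv
    have hup : w + Pi.single l v = Function.update w l (w l + v) := by
      ext a i
      by_cases ha : a = l
      · subst ha; simp
      · simp [ha]
    exact hup ▸ (linearIndependent_update_iff hw l _).2 hwv
  have hself : ∀ {w : κ → Fin m → F}, LinearIndependent F w →
      w l ∉ Submodule.span F (w '' {l}ᶜ) := fun {w} hw =>
    (linearIndependent_update_iff hw l _).1 (by simpa using hw)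
  by_cases hl : ∃ l', l' ≠ l
  · -- make `v` another member of the family
    obtain ⟨l', hl'⟩ := hl
    obtain ⟨w, hw, rfl⟩ := exists_linearIndependent_apply_eq hκ l' hv
    refine ⟨w, hw, key hw fun hmem => hself hw ?_⟩
    have hl'mem : w l' ∈ Submodule.span F (w '' {l}ᶜ) :=
      Submodule.subset_span (Set.mem_image_of_mem w hl')
    exact (Submodule.add_mem_iff_left _ hl'mem).1 hmem
  · push Not at hl
    have hcompl : ({l}ᶜ : Set κ) = ∅ := by ext a; simp [hl a]
    have hsub : Subsingleton κ := ⟨fun a b => (hl a).trans (hl b).symm⟩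
    have hone : ∀ {z : Fin m → F}, z ≠ 0 → LinearIndependent F fun _ : κ => z := fun {z} hz =>
      LinearIndependent.of_subsingleton l hz
    rcases h with h | h
    · -- take a vector that is independent of `v`
      obtain ⟨w, hw, hwv⟩ := exists_linearIndependent_apply_eq (κ := Fin 2) (F := F) (m := m)
        (by simpa using h) 0 hv
      have hsum : w 1 + v ≠ 0 := by
        intro h0
        refine (linearIndependent_fin2.1 hw).2 (-1) ?_
        rw [hwv, neg_one_smul, eq_neg_of_add_eq_zero_left h0, neg_neg]
      refine ⟨fun _ => w 1, hone (hw.ne_zero 1), key (hone (hw.ne_zero 1)) ?_⟩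
      simpa [hcompl] using hsum
    · -- take a multiple of `v` by a scalar other than `0` and `-1`
      obtain ⟨c, hc0, hc1⟩ : ∃ c : F, c ≠ 0 ∧ c ≠ -1 := by
        by_contra! hcon
        have : (Set.univ : Set F) ⊆ {0, -1} := fun c _ => by
          by_cases hc : c = 0
          · simp [hc]
          · simp [hcon c hc]
        have h2 : (Set.univ : Set F).encard ≤ 2 :=
          (Set.encard_le_encard this).trans (Set.encard_insert_le _ _ |>.trans (by
            simp [one_add_one_eq_two]))
        rw [Set.encard_univ] at h2
        exact absurd (h.trans h2) (by norm_num)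
      have hcv : c • v ≠ 0 := smul_ne_zero hc0 hv
      refine ⟨fun _ => c • v, hone hcv, key (hone hcv) ?_⟩
      have : c • v + v = (c + 1) • v := by rw [add_smul, one_smul]
      simp only [hcompl, Set.image_empty, Submodule.span_empty, Submodule.mem_bot, this]
      exact smul_ne_zero (fun h0 => hc1 (eq_neg_of_add_eq_zero_left h0)) hv

end LinearIndependence

section RowRank

variable {F κ : Type*} [Field F] [Fintype κ] {n m : ℕ}

lemma finrank_span_rows_eq_rank (M : Matrix (Fin n) (Fin m) F) :
    Module.finrank F (Submodule.span F (Set.range fun i => M i)) = M.rank :=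
  (M.rank_eq_finrank_span_row).symm

lemma card_le_rank_of_linearIndependent {M : Matrix (Fin n) (Fin m) F} {f : κ → Fin n}
    (h : LinearIndependent F fun a => M (f a)) : Fintype.card κ ≤ M.rank := by
  rw [← finrank_span_rows_eq_rank, ← finrank_span_eq_card h]
  exact Submodule.finrank_mono (Submodule.span_mono (Set.range_comp_subset_range f fun i => M i))

lemma row_mem_span_of_rank_le {M : Matrix (Fin n) (Fin m) F} {f : κ → Fin n}
    (h : LinearIndependent F fun a => M (f a)) (hM : M.rank ≤ Fintype.card κ) (i : Fin n) :
    M i ∈ Submodule.span F (Set.range fun a => M (f a)) := by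
  have hle : Submodule.span F (Set.range fun a => M (f a)) ≤
      Submodule.span F (Set.range fun i => M i) :=
    Submodule.span_mono (Set.range_comp_subset_range f fun i => M i)
  rw [Submodule.eq_of_le_of_finrank_le hle
    (by rw [finrank_span_rows_eq_rank, finrank_span_eq_card h]; exact hM)]
  exact Submodule.subset_span ⟨i, rfl⟩

end RowRank

/-! ### Rook placements that meet a set of cells equally often -/

section Rooks

variable {n m : ℕ}

/-- The number of cells of `Q` that the placement of one rook in each row, given by `σ`, meets. -/
def rookCount (Q : Finset (Fin n × Fin m)) (σ : Fin n ↪ Fin m) : ℕ :=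
  ∑ i, if (i, σ i) ∈ Q then 1 else 0

lemma rookCount_le (Q : Finset (Fin n × Fin m)) (σ : Fin n ↪ Fin m) : rookCount Q σ ≤ n := by
  have : rookCount Q σ ≤ ∑ _i : Fin n, 1 :=
    Finset.sum_le_sum fun i _ => by split <;> simp
  simpa using this

/-- The cyclic shifts of a placement partition the board. -/
lemma sum_rookCount_shift [NeZero m] (Q : Finset (Fin n × Fin m)) (σ : Fin n ↪ Fin m) :
    ∑ k : Fin m, rookCount Q (σ.trans (Equiv.addRight k).toEmbedding) = Q.card := by
  have h : ∀ i : Fin n, ∑ k : Fin m, (if (i, σ i + k) ∈ Q then 1 else 0) =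
      ∑ c : Fin m, if (i, c) ∈ Q then 1 else 0 := fun i =>
    Equiv.sum_comp (Equiv.addLeft (σ i)) fun c => if (i, c) ∈ Q then 1 else 0
  simp only [rookCount, Function.Embedding.trans_apply, Equiv.coe_toEmbedding,
    Equiv.coe_addRight]
  rw [Finset.sum_comm, Finset.sum_congr rfl fun i _ => h i,
    ← Fintype.sum_prod_type' (f := fun i c => if (i, c) ∈ Q then 1 else 0)]
  simp

lemma card_le_of_rookCount_le [NeZero m] {Q : Finset (Fin n × Fin m)} {ν : ℕ} (hnm : n ≤ m)
    (h : ∀ σ, rookCount Q σ ≤ ν) : Q.card ≤ m * ν := by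
  rw [← sum_rookCount_shift Q (Fin.castLEEmb hnm)]
  simpa using Finset.sum_le_sum fun k (_ : k ∈ (Finset.univ : Finset (Fin m))) =>
    h ((Fin.castLEEmb hnm).trans (Equiv.addRight k).toEmbedding)

/-- If the bound `|Q| ≤ m ν` is attained, then every placement meets `Q` in exactly `ν` cells. -/
lemma rookCount_eq_of_card_eq [NeZero m] {Q : Finset (Fin n × Fin m)} {ν : ℕ}
    (h : ∀ σ, rookCount Q σ ≤ ν) (hQ : Q.card = m * ν) (σ : Fin n ↪ Fin m) :
    rookCount Q σ = ν := by
  have hsum := sum_rookCount_shift Q σ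
  have hconst : m * ν = ∑ _k : Fin m, ν := by simp
  rw [hQ, hconst, Finset.sum_eq_sum_iff_of_le fun k _ => h _] at hsum
  have h0 := hsum 0 (Finset.mem_univ _)
  rw [← h0]
  congr 1
  ext i
  simp

lemma exists_perm_apply_eq_and {α : Type*} [DecidableEq α] {a b c d : α} (hab : a ≠ b)
    (hcd : c ≠ d) : ∃ π : Equiv.Perm α, π a = c ∧ π b = d := by
  refine ⟨(Equiv.swap a c).trans (Equiv.swap (Equiv.swap a c b) d), ?_, ?_⟩
  · have h : Equiv.swap a c b ≠ c := fun h => hab (by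
      rw [Equiv.swap_apply_eq_iff, Equiv.swap_apply_right] at h; exact h.symm)
    simp [Equiv.swap_apply_of_ne_of_ne h.symm hcd]
  · simp

/-- If all placements meet `Q` equally often and `n < m`, then `Q` is a union of rows: the rook
in one row can be moved to a column that is not in use. -/
lemma mem_iff_mem_of_rookCount_eq_of_lt {Q : Finset (Fin n × Fin m)} {ν : ℕ} (hnm : n < m)
    (h : ∀ σ, rookCount Q σ = ν) (i : Fin n) (c c' : Fin m) : (i, c) ∈ Q ↔ (i, c') ∈ Q := by
  rcases eq_or_ne c c' with rfl | hcc
  · rfl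
  obtain ⟨π, hπc, hπc'⟩ := exists_perm_apply_eq_and (a := Fin.castLE hnm.le i)
    (b := (⟨n, hnm⟩ : Fin m)) (by simp [Fin.ext_iff, i.2.ne]) hcc
  set σ : Fin n ↪ Fin m := (Fin.castLEEmb hnm.le).trans π.toEmbedding with hσ
  have hσi : σ i = c := hπc
  have hσc' : ∀ a, σ a ≠ c' := fun a ha => by
    have := π.injective (ha.trans hπc'.symm)
    simp [Fin.ext_iff, a.2.ne] at this
  have heq := (h σ).trans (h (σ.trans (Equiv.swap c c').toEmbedding)).symm
  simp only [rookCount] at heq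
  rw [← Finset.add_sum_erase _ _ (Finset.mem_univ i),
    ← Finset.add_sum_erase (a := i) _ _ (Finset.mem_univ i),
    Finset.sum_congr rfl (g := fun a => if (a, (σ.trans (Equiv.swap c c').toEmbedding) a) ∈ Q
      then 1 else 0) (fun a ha => ?_)] at heq
  · have h2 := Nat.add_right_cancel heq
    simp only [Function.Embedding.trans_apply, hσi, Equiv.coe_toEmbedding,
      Equiv.swap_apply_left] at h2
    split_ifs at h2 <;> simp_all
  · have hne : σ a ≠ c := fun hac => Finset.ne_of_mem_erase ha (σ.injective (hac.trans hσi.symm))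
    simp [Equiv.swap_apply_of_ne_of_ne hne (hσc' a)]

/-- On a square board, exchanging the columns of two rooks gives the additive relation that says
that the indicator function of `Q` is a sum of a function of the row and one of the column. -/
lemma indicator_add_indicator_of_rookCount_eq {Q : Finset (Fin n × Fin n)} {ν : ℕ}
    (h : ∀ σ, rookCount Q σ = ν) {i i' c c' : Fin n} (hii : i ≠ i') (hcc : c ≠ c') :
    (if (i, c) ∈ Q then 1 else 0) + (if (i', c') ∈ Q then 1 else 0) =
      (if (i, c') ∈ Q then 1 else 0) + (if (i', c) ∈ Q then 1 else 0) := by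
  obtain ⟨π, hπc, hπc'⟩ := exists_perm_apply_eq_and hii hcc
  have heq := (h π.toEmbedding).trans
    (h (π.toEmbedding.trans (Equiv.swap c c').toEmbedding)).symm
  simp only [rookCount] at heq
  have hi' : i' ∈ (Finset.univ : Finset (Fin n)).erase i := by simp [hii.symm]
  rw [← Finset.add_sum_erase _ _ (Finset.mem_univ i),
    ← Finset.add_sum_erase _ _ hi',
    ← Finset.add_sum_erase (a := i) _ _ (Finset.mem_univ i),
    ← Finset.add_sum_erase (a := i') _ _ hi', ← add_assoc, ← add_assoc,
    Finset.sum_congr rfl (g := fun a =>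
      if (a, (π.toEmbedding.trans (Equiv.swap c c').toEmbedding) a) ∈ Q
      then 1 else 0) (fun a ha => ?_)] at heq
  · have h2 := Nat.add_right_cancel heq
    simpa [hπc, hπc'] using h2
  · simp only [Finset.mem_erase, Finset.mem_univ, and_true] at ha
    have h1 : π a ≠ c := fun hac => ha.2 (π.injective (hac.trans hπc.symm))
    have h2 : π a ≠ c' := fun hac => ha.1 (π.injective (hac.trans hπc'.symm))
    simp [Equiv.swap_apply_of_ne_of_ne h1 h2]

/-- If all placements meet a part `Q` of a square board equally often, then `Q` is a union of rows
or a union of columns. -/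
lemma rows_or_columns_of_rookCount_eq {Q : Finset (Fin n × Fin n)} {ν : ℕ}
    (h : ∀ σ, rookCount Q σ = ν) :
    (∀ i c c', (i, c) ∈ Q ↔ (i, c') ∈ Q) ∨ (∀ c i i', (i, c) ∈ Q ↔ (i', c) ∈ Q) := by
  by_cases hrow : ∀ i c c', (i, c) ∈ Q → (i, c') ∈ Q
  · exact .inl fun i c c' => ⟨hrow i c c', hrow i c' c⟩
  refine .inr ?_
  push Not at hrow
  obtain ⟨i₀, c₁, c₂, h₁, h₂⟩ := hrow
  -- every row agrees with the mixed row `i₀`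
  have hi₀ : ∀ i c, (i, c) ∈ Q ↔ (i₀, c) ∈ Q := by
    intro i c
    rcases eq_or_ne i₀ i with rfl | hi
    · rfl
    have hc : c₁ ≠ c₂ := fun hc => h₂ (hc ▸ h₁)
    have e := indicator_add_indicator_of_rookCount_eq h hi hc
    simp only [h₁, h₂, if_true, if_false] at e
    have e₁ : (i, c₁) ∈ Q ∧ (i, c₂) ∉ Q := by
      constructor
      · by_contra hn; simp [hn] at e
      · intro hn; simp only [hn, if_true] at e; split_ifs at e <;> omega
    by_cases hc₀ : (i₀, c) ∈ Q
    · have hne : c ≠ c₂ := fun hc => h₂ (hc ▸ hc₀)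
      have e' := indicator_add_indicator_of_rookCount_eq h hi hne
      simp only [hc₀, h₂, e₁.2, if_true, if_false] at e'
      refine iff_of_true ?_ hc₀
      by_contra hn; simp [hn] at e'
    · have hne : c ≠ c₁ := fun hc => hc₀ (hc ▸ h₁)
      have e' := indicator_add_indicator_of_rookCount_eq h hi hne
      simp only [hc₀, h₁, e₁.1, if_true, if_false] at e'
      refine iff_of_false ?_ hc₀
      intro hn; simp [hn] at e'
  exact fun c i i' => (hi₀ i c).trans (hi₀ i' c).symm

/-- The cells of a set `Q` that all placements meet equally often become, after a rank-preserving
coordinate change (the identity or a transposition), the cells of a set `I` of full rows. -/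
lemma exists_linearEquiv_rows {F : Type*} [Field F] {Q : Finset (Fin n × Fin m)} {ν : ℕ}
    (hnm : n ≤ m) (hm : 0 < m) (h : ∀ σ, rookCount Q σ = ν) :
    ∃ (T : Matrix (Fin n) (Fin m) F ≃ₗ[F] Matrix (Fin n) (Fin m) F) (I : Finset (Fin n)),
      (∀ M, (T M).rank = M.rank) ∧ m * I.card = Q.card ∧
      ∀ M, (∀ i ∈ I, T M i = 0) → ∀ q ∈ Q, M q.1 q.2 = 0 := by
  have hrows : (∀ i c c', (i, c) ∈ Q ↔ (i, c') ∈ Q) → ∃ (T : Matrix (Fin n) (Fin m) F ≃ₗ[F]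
      Matrix (Fin n) (Fin m) F) (I : Finset (Fin n)),
      (∀ M, (T M).rank = M.rank) ∧ m * I.card = Q.card ∧
      ∀ M, (∀ i ∈ I, T M i = 0) → ∀ q ∈ Q, M q.1 q.2 = 0 := by
    intro hQ
    obtain ⟨I, rfl⟩ : ∃ I : Finset (Fin n), Q = I ×ˢ Finset.univ :=
      ⟨Finset.univ.filter fun i => (i, ⟨0, hm⟩) ∈ Q, by
        ext ⟨i, c⟩
        simpa using hQ i c _⟩
    refine ⟨LinearEquiv.refl F _, I, fun M => rfl, by simp [mul_comm], fun M hM q hq => ?_⟩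
    simp only [Finset.mem_product, Finset.mem_univ, and_true] at hq
    exact congrFun (hM q.1 hq) q.2
  rcases hnm.lt_or_eq with hlt | rfl
  · exact hrows (mem_iff_mem_of_rookCount_eq_of_lt hlt h)
  · rcases rows_or_columns_of_rookCount_eq h with hQ | hQ
    · exact hrows hQ
    · obtain ⟨I, rfl⟩ : ∃ I : Finset (Fin n), Q = Finset.univ ×ˢ I :=
        ⟨Finset.univ.filter fun c => (⟨0, hm⟩, c) ∈ Q, by
          ext ⟨i, c⟩
          simpa using hQ c i _⟩
      refine ⟨Matrix.transposeLinearEquiv (Fin n) (Fin n) F F, I, fun M => M.rank_transpose,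
        by simp, fun M hM q hq => ?_⟩
      simp only [Finset.mem_product, Finset.mem_univ, true_and] at hq
      exact congrFun (hM q.2 hq) q.1

end Rooks

/-! ### Leading cells -/

section LeadingCells

variable {F : Type*} [Field F] {t : ℕ} {n m : Fin t → ℕ}

/-- The position of a cell when the blocks are read in order, each one row by row. -/
def cellKey (p : (j : Fin t) × Fin (n j) × Fin (m j)) : Fin t ×ₗ (ℕ ×ₗ ℕ) :=
  toLex (p.1, toLex (p.2.1.val, p.2.2.val))

/-- A cell is leading for `A` if it is the first nonzero cell of some element of `A`. -/
def IsLeading (A : Submodule F (Space F n m)) (p : (j : Fin t) × Fin (n j) × Fin (m j)) : Prop :=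
  ∃ X ∈ A, X p.1 p.2.1 p.2.2 ≠ 0 ∧ ∀ q, cellKey q < cellKey p → X q.1 q.2.1 q.2.2 = 0

open Classical in
/-- The leading cells of `A` in block `j`. -/
noncomputable def leadingCells (A : Submodule F (Space F n m)) (j : Fin t) :
    Finset (Fin (n j) × Fin (m j)) :=
  Finset.univ.filter fun q => IsLeading A ⟨j, q⟩

lemma mem_leadingCells {A : Submodule F (Space F n m)} {j : Fin t} {q : Fin (n j) × Fin (m j)} :
    q ∈ leadingCells A j ↔ IsLeading A ⟨j, q⟩ := by
  simp [leadingCells]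

lemma cellKey_lt {j k : Fin t} {i : Fin (n j)} {c : Fin (m j)} {i' : Fin (n k)} {c' : Fin (m k)} :
    cellKey (⟨j, i, c⟩ : (j : Fin t) × Fin (n j) × Fin (m j)) < cellKey ⟨k, i', c'⟩ ↔
      j < k ∨ j = k ∧ (i.val < i'.val ∨ i.val = i'.val ∧ c.val < c'.val) := by
  simp [cellKey, Prod.Lex.toLex_lt_toLex]

lemma eq_zero_of_leadingCells {A : Submodule F (Space F n m)} {X : Space F n m} (hX : X ∈ A)
    (h : ∀ j, ∀ q ∈ leadingCells A j, X j q.1 q.2 = 0) : X = 0 := by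
  classical
  by_contra hne
  obtain ⟨p₀, hp₀⟩ : ∃ p : (j : Fin t) × Fin (n j) × Fin (m j), X p.1 p.2.1 p.2.2 ≠ 0 := by
    by_contra! hall
    exact hne (funext fun j => by ext i c; exact hall ⟨j, i, c⟩)
  obtain ⟨p, hp, hmin⟩ := (Finset.univ.filter fun p : (j : Fin t) × Fin (n j) × Fin (m j) =>
    X p.1 p.2.1 p.2.2 ≠ 0).exists_min_image cellKey ⟨p₀, by simpa using hp₀⟩
  simp only [Finset.mem_filter, Finset.mem_univ, true_and] at hp hmin
  refine hp (h p.1 p.2 (mem_leadingCells.2 ⟨X, hX, hp, fun q hq => ?_⟩))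
  by_contra hq0
  exact (hmin q hq0).not_gt hq

/-- A placement of rooks meets the leading cells of a linear `r`-anticode at most `r` times,
because the rows of some element of the anticode through these cells are independent. -/
lemma sum_rookCount_leadingCells_le {A : Submodule F (Space F n m)} {r : ℕ}
    (hr : ∀ X ∈ A, srk X ≤ r) (σ : (j : Fin t) → Fin (n j) ↪ Fin (m j)) :
    ∑ j, rookCount (leadingCells A j) (σ j) ≤ r := by
  classical
  set S : (j : Fin t) → Finset (Fin (n j)) := fun j =>
    Finset.univ.filter fun i => (i, σ j i) ∈ leadingCells A j with hS
  have h : ∀ l : (j : Fin t) × S j, IsLeading A ⟨l.1, l.2.1, σ l.1 l.2.1⟩ := fun l =>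
    mem_leadingCells.1 (Finset.mem_filter.1 l.2.2).2
  choose x hxA hx0 hxlow using h
  have hindr : LinearIndependent F fun l : (j : Fin t) × S j =>
      (Pi.single l.1 (x l l.1 l.2.1) : (k : Fin t) → Fin (m k) → F) := by
    refine linearIndependent_of_triangular _
      (fun l => LinearMap.proj (σ l.1 l.2.1) ∘ₗ LinearMap.proj l.1)
      (fun l => (toLex (l.1, (σ l.1 l.2.1).val) : Fin t ×ₗ ℕ)) ?_ ?_ ?_
    · rintro ⟨j, i, hi⟩ ⟨k, i', hi'⟩ hjk
      simp only [EmbeddingLike.apply_eq_iff_eq, Prod.mk.injEq] at hjk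
      obtain ⟨rfl, h⟩ := hjk
      obtain rfl := (σ j).injective (Fin.ext h)
      rfl
    · intro l
      simpa using hx0 l
    · rintro ⟨j, i, hi⟩ ⟨k, i', hi'⟩ hlt
      simp only [Prod.Lex.toLex_lt_toLex] at hlt
      rcases eq_or_ne k j with rfl | hkj
      · simp only [lt_self_iff_false, true_and, false_or] at hlt
        simpa using hxlow ⟨k, i, hi⟩ ⟨k, i, σ k i'⟩ (cellKey_lt.2 (by simpa using hlt))
      · simp [Pi.single_eq_of_ne hkj]
  have hlow : ∀ l a : (j : Fin t) × S j, l ≠ a →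
      (toLex (l.1, l.2.1.val) : Fin t ×ₗ ℕ) ≤ toLex (a.1, a.2.1.val) → x a l.1 l.2.1 = 0 := by
    rintro ⟨j, i, hi⟩ ⟨k, i', hi'⟩ hne hle
    ext c
    refine hxlow ⟨k, i', hi'⟩ ⟨j, i, c⟩ (cellKey_lt.2 ?_)
    simp only [Prod.Lex.toLex_le_toLex] at hle
    rcases hle with hjk | ⟨rfl, hii⟩
    · exact .inl hjk
    · refine .inr ⟨rfl, .inl (lt_of_le_of_ne hii fun h => hne ?_)⟩
      obtain rfl := Fin.ext h
      rfl
  obtain ⟨X, hXA, hX⟩ := exists_linearIndependent_apply A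
    (fun l : (j : Fin t) × S j => LinearMap.single F (fun k => Fin (m k) → F) l.1 ∘ₗ
      (LinearMap.proj (R := F) (φ := fun _ : Fin (n l.1) => Fin (m l.1) → F) l.2.1) ∘ₗ
      (LinearMap.proj (R := F) (φ := fun k => Matrix (Fin (n k)) (Fin (m k)) F) l.1))
    x hxA (fun l => (toLex (l.1, l.2.1.val) : Fin t ×ₗ ℕ))
    (fun l a hne hle => (congrArg (LinearMap.single F (fun k => Fin (m k) → F) l.1)
      (hlow l a hne hle)).trans (map_zero _)) hindr
  have hrank : ∀ j, rookCount (leadingCells A j) (σ j) ≤ (X j).rank := by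
    intro j
    have hj : LinearIndependent F fun i : S j => X j i.1 := by
      have := hX.comp (fun i : S j => (⟨j, i⟩ : (j : Fin t) × S j))
        (sigma_mk_injective (β := fun j => S j))
      exact LinearIndependent.of_comp (LinearMap.single F (fun k => Fin (m k) → F) j) this
    have := card_le_rank_of_linearIndependent hj
    rw [Fintype.card_coe] at this
    simpa [rookCount, hS] using this
  exact (Finset.sum_le_sum fun j _ => hrank j).trans (hr X hXA)

end LeadingCells

/-! ### Frames of optimal anticodes -/

section Frames

variable {F : Type*} [Field F] {t : ℕ} {n m : Fin t → ℕ}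

/-- A profile can be enlarged within its bounds to any larger sum. -/
lemma exists_mem_profiles_ge {ν : Fin t → ℕ} (hν : ∀ j, ν j ≤ n j) {r : ℕ} (h : ∑ j, ν j ≤ r)
    (hr : r ≤ ∑ j, n j) : ∃ u ∈ profiles n r, ∀ j, ν j ≤ u j := by
  induction r, h using Nat.le_induction with
  | base => exact ⟨ν, ⟨hν, rfl⟩, fun _ => le_rfl⟩
  | succ r _ ih =>
    obtain ⟨u, ⟨hun, hur⟩, hu⟩ := ih (by omega)
    obtain ⟨k, -, hk⟩ := Finset.exists_lt_of_sum_lt (show ∑ j, u j < ∑ j, n j by omega)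
    refine ⟨fun j => u j + if j = k then 1 else 0, ⟨fun j => ?_, ?_⟩, fun j => ?_⟩
    · dsimp only
      split_ifs with hj
      · subst hj; omega
      · exact hun j
    · simp [Finset.sum_add_distrib, hur]
    · exact (hu j).trans (Nat.le_add_right _ _)

/-- A profile of maximal weight fills the wide blocks before it uses a narrower one. -/
lemma eq_zero_of_isGreatest_profile {ν : Fin t → ℕ} {r : ℕ} (hν : ν ∈ profiles n r)
    (hmax : ∀ u ∈ profiles n r, ∑ j, m j * u j ≤ ∑ j, m j * ν j) {j k : Fin t}
    (hjk : m k < m j) (hj : ν j < n j) : ν k = 0 := by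
  by_contra hk
  have hne : j ≠ k := by rintro rfl; exact hjk.false
  set u : Fin t → ℕ := fun i => if i = j then ν i + 1 else if i = k then ν i - 1 else ν i with hu
  have key : ∀ i, (u i + if i = k then 1 else 0) = ν i + if i = j then 1 else 0 := by
    intro i
    simp only [hu]
    by_cases hij : i = j
    · subst hij; simp [hne]
    · by_cases hik : i = k
      · subst hik; simp [hij]; omega
      · simp [hij, hik]
  have hsum : ∑ i, u i = r := by
    have := Finset.sum_congr rfl fun i (_ : i ∈ Finset.univ) => key i
    simp only [Finset.sum_add_distrib, Finset.sum_ite_eq', Finset.mem_univ, if_true] at this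
    rw [← hν.2]
    omega
  have hun : ∀ i, u i ≤ n i := by
    intro i
    have hi := hν.1 i
    simp only [hu]
    split_ifs with h1 h2
    · subst h1; omega
    · omega
    · exact hi
  have hw : ∑ i, m i * u i + m k = ∑ i, m i * ν i + m j := by
    have := Finset.sum_congr rfl fun i (_ : i ∈ Finset.univ) => congrArg (m i * ·) (key i)
    simpa [mul_add, Finset.sum_add_distrib] using this
  have := hmax u ⟨hun, hsum⟩
  omega

/-- The `i`-th row of block `j` after the coordinate changes `T` of the blocks. -/
def row (T : (j : Fin t) → Matrix (Fin (n j)) (Fin (m j)) F ≃ₗ[F] Matrix (Fin (n j)) (Fin (m j)) F)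
    (j : Fin t) (i : Fin (n j)) : Space F n m →ₗ[F] Fin (m j) → F :=
  LinearMap.proj (R := F) (φ := fun _ => Fin (m j) → F) i ∘ₗ (T j).toLinearMap ∘ₗ
    LinearMap.proj (R := F) (φ := fun j => Matrix (Fin (n j)) (Fin (m j)) F) j

section Row

variable {T : (j : Fin t) → Matrix (Fin (n j)) (Fin (m j)) F ≃ₗ[F] Matrix (Fin (n j)) (Fin (m j)) F}
  {X Y : Space F n m} {j : Fin t}

lemma row_congr (h : X j = Y j) (i : Fin (n j)) : row T j i X = row T j i Y :=
  congrArg (fun M => T j M i) h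

lemma row_eq_zero (h : X j = 0) (i : Fin (n j)) : row T j i X = 0 :=
  (row_congr (Y := 0) h i).trans (map_zero _)

lemma apply_eq_zero_of_rows (h : ∀ i, row T j i X = 0) : X j = 0 :=
  (T j).map_eq_zero_iff.1 (funext h)

end Row

/-- A frame of a linear anticode `A` presents it, up to rank-preserving coordinate changes `T j` of
the blocks, as the graph of a linear map that expresses all rows in terms of freely chosen ones: the
rows in `I j` of the transformed blocks `T j (X j)` are arbitrary and determine `X`.  There are as
many chosen rows as the sum-rank in `A` allows, and they use wide blocks first. -/
structure IsFrame (A : Submodule F (Space F n m))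
    (T : (j : Fin t) → Matrix (Fin (n j)) (Fin (m j)) F ≃ₗ[F] Matrix (Fin (n j)) (Fin (m j)) F)
    (I : (j : Fin t) → Finset (Fin (n j))) : Prop where
  rank_eq : ∀ j M, (T j M).rank = M.rank
  srk_le : ∀ X ∈ A, srk X ≤ ∑ j, (I j).card
  eq_empty : ∀ j k, m k < m j → (I j).card < n j → I k = ∅
  bijective : Function.Bijective
    fun (X : A) (j : Fin t) (i : I j) => row T j i X.1

/-- Leading cells meet every placement of rooks in at most `r` cells, so an anticode whose dimension
attains the maximum has leading cells that fill rows, or columns of square blocks; transposing the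
latter blocks gives a frame. -/
lemma exists_isFrame (hm : ∀ j, 0 < m j) (hnm : ∀ j, n j ≤ m j) {A : Submodule F (Space F n m)}
    (hA : IsOptimalLinearAnticode A) :
    ∃ (T : (j : Fin t) → Matrix (Fin (n j)) (Fin (m j)) F ≃ₗ[F] Matrix (Fin (n j)) (Fin (m j)) F)
      (I : (j : Fin t) → Finset (Fin (n j))), IsFrame A T I := by
  classical
  obtain ⟨r, ⟨hrN, -, hr⟩, -, hmax⟩ := hA
  replace hr : ∀ X ∈ A, srk X ≤ r := fun X hX => by simpa using hr X hX 0 A.zero_mem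
  replace hmax : ∀ u ∈ profiles n r, ∑ j, m j * u j ≤ Module.finrank F A := fun u hu =>
    hmax ⟨u, hu, rfl⟩
  -- `ν j` is the largest number of leading cells of block `j` that a placement meets
  have hσ : ∀ j, ∃ σ : Fin (n j) ↪ Fin (m j), ∀ σ',
      rookCount (leadingCells A j) σ' ≤ rookCount (leadingCells A j) σ := fun j => by
    have : Nonempty (Fin (n j) ↪ Fin (m j)) := ⟨Fin.castLEEmb (hnm j)⟩
    exact Finite.exists_max _
  choose σ hσ using hσ
  set ν : Fin t → ℕ := fun j => rookCount (leadingCells A j) (σ j) with hν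
  have hcard : ∀ j, (leadingCells A j).card ≤ m j * ν j := fun j => by
    have : NeZero (m j) := ⟨(hm j).ne'⟩
    exact card_le_of_rookCount_le (hnm j) (hσ j)
  have hinj : ∀ X ∈ A, (∀ j, ∀ q ∈ leadingCells A j, X j q.1 q.2 = 0) → X = 0 :=
    fun X hX h => eq_zero_of_leadingCells hX h
  have hdim : Module.finrank F A ≤ ∑ j, (leadingCells A j).card := by
    let f : A →ₗ[F] (p : (j : Fin t) × leadingCells A j) → F :=
      LinearMap.pi fun p => LinearMap.proj (R := F) (φ := fun _ => F) p.2.1.2 ∘ₗ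
        LinearMap.proj (R := F) (φ := fun _ => Fin (m p.1) → F) p.2.1.1 ∘ₗ
        LinearMap.proj (R := F) (φ := fun j => Matrix (Fin (n j)) (Fin (m j)) F) p.1 ∘ₗ A.subtype
    have hf : Function.Injective f := by
      rw [injective_iff_map_eq_zero]
      intro X hX
      exact Subtype.ext (hinj X.1 X.2 fun j q hq => congrFun hX ⟨j, q, hq⟩)
    simpa using LinearMap.finrank_le_finrank_of_injective hf
  obtain ⟨u, hu, hνu⟩ := exists_mem_profiles_ge (n := n) (ν := ν) (fun j => rookCount_le _ _)
    (sum_rookCount_leadingCells_le hr σ) hrN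
  -- all inequalities between the dimension and the weights of `ν` and `u` are equalities
  have h1 : ∑ j, (leadingCells A j).card ≤ ∑ j, m j * ν j := Finset.sum_le_sum fun j _ => hcard j
  have h2 : ∑ j, m j * ν j ≤ ∑ j, m j * u j :=
    Finset.sum_le_sum fun j _ => Nat.mul_le_mul_left _ (hνu j)
  have h3 := hmax u hu
  have hcard' : ∀ j, (leadingCells A j).card = m j * ν j := fun j =>
    (Finset.sum_eq_sum_iff_of_le fun j _ => hcard j).1 (by omega) j (Finset.mem_univ j)
  have huν : u = ν := funext fun j => by
    have := (Finset.sum_eq_sum_iff_of_le fun j _ => Nat.mul_le_mul_left (m j) (hνu j)).1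
      (by omega) j (Finset.mem_univ j)
    exact (Nat.eq_of_mul_eq_mul_left (hm j) this).symm
  subst huν
  have hrows := fun j => by
    have : NeZero (m j) := ⟨(hm j).ne'⟩
    exact exists_linearEquiv_rows (F := F) (hnm j) (hm j)
      (rookCount_eq_of_card_eq (hσ j) (hcard' j))
  choose T I hT hI hTI using hrows
  have hIcard : ∀ j, (I j).card = ν j := fun j =>
    Nat.eq_of_mul_eq_mul_left (hm j) ((hI j).trans (hcard' j))
  refine ⟨T, I, hT, fun X hX => ?_, fun j k hjk hj => ?_, ?_⟩
  · simpa only [hIcard, hu.2] using hr X hX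
  · rw [hIcard] at hj
    rw [← Finset.card_eq_zero, hIcard]
    exact eq_zero_of_isGreatest_profile hu (fun u' hu' => (hmax u' hu').trans (by omega)) hjk hj
  · let f : A →ₗ[F] (j : Fin t) → I j → Fin (m j) → F :=
      LinearMap.pi fun j => LinearMap.pi fun i => row T j i.1 ∘ₗ A.subtype
    have hf : Function.Injective f := by
      rw [injective_iff_map_eq_zero]
      intro X hX
      refine Subtype.ext (hinj X.1 X.2 fun j q hq => hTI j (X.1 j) (fun i hi => ?_) q hq)
      exact congrFun (congrFun hX j) ⟨i, hi⟩
    refine ⟨hf, (LinearMap.injective_iff_surjective_of_finrank_eq_finrank ?_).1 hf⟩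
    rw [Module.finrank_pi_fintype]
    simp only [Module.finrank_pi_fintype, Module.finrank_self, Finset.sum_const, Finset.card_univ,
      Fintype.card_fin, Fintype.card_coe, smul_eq_mul, mul_one, hIcard]
    simp only [mul_comm (ν _)]
    omega

end Frames

/-! ### Splitting off blocks -/

section Splitting

variable {F : Type*} [Field F] {t : ℕ} {n m : Fin t → ℕ} {A : Submodule F (Space F n m)}
  {T : (j : Fin t) → Matrix (Fin (n j)) (Fin (m j)) F ≃ₗ[F] Matrix (Fin (n j)) (Fin (m j)) F}
  {I : (j : Fin t) → Finset (Fin (n j))}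

namespace IsFrame

lemma exists_rows_eq (h : IsFrame A T I) (y : (j : Fin t) → I j → Fin (m j) → F) :
    ∃ X ∈ A, ∀ j (i : I j), row T j i X = y j i := by
  obtain ⟨X, hX⟩ := h.bijective.2 y
  exact ⟨X.1, X.2, fun j i => congrFun (congrFun hX j) i⟩

lemma eq_of_rows_eq (h : IsFrame A T I) {X Y : Space F n m} (hX : X ∈ A) (hY : Y ∈ A)
    (hXY : ∀ j (i : I j), row T j i X = row T j i Y) : X = Y :=
  congrArg Subtype.val (h.bijective.1 (a₁ := ⟨X, hX⟩) (a₂ := ⟨Y, hY⟩)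
    (funext fun j => funext fun i => hXY j i))

lemma card_le_rank (h : IsFrame A T I) {X : Space F n m} {j : Fin t}
    (hX : LinearIndependent F fun i : I j => row T j i X) : (I j).card ≤ (X j).rank := by
  rw [← h.rank_eq, ← Fintype.card_coe]
  exact card_le_rank_of_linearIndependent hX

/-- If the chosen rows are independent in each block, they span the row space of each block, since
the sum-rank cannot be larger than their number. -/
lemma row_mem_span (h : IsFrame A T I) {X : Space F n m} (hXA : X ∈ A)
    (hX : ∀ j, LinearIndependent F fun i : I j => row T j i X) (j : Fin t) (i : Fin (n j)) :
    row T j i X ∈ Submodule.span F (Set.range fun i : I j => row T j i X) := by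
  have hle : ∀ j ∈ Finset.univ, (I j).card ≤ (X j).rank := fun j _ => h.card_le_rank (hX j)
  have heq := (Finset.sum_eq_sum_iff_of_le hle).1
    ((Finset.sum_le_sum hle).antisymm (h.srk_le X hXA)) j (Finset.mem_univ j)
  refine row_mem_span_of_rank_le (M := T j (X j)) (f := fun i : I j => i.1) (hX j) ?_ i
  rw [h.rank_eq, ← heq, Fintype.card_coe]

/-- An element of `A` whose chosen rows vanish outside block `k` vanishes in the other blocks `j`:
a row of block `j` changes by an element of the span of the chosen rows of block `j` when those of
block `k` are changed, and the former are arbitrary. -/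
lemma apply_eq_zero_of_ne (h : IsFrame A T I) (hnm : ∀ j, n j ≤ m j) {X : Space F n m}
    (hX : X ∈ A) {j k : Fin t} (hjk : j ≠ k) (hX0 : ∀ i ≠ k, ∀ l : I i, row T i l X = 0)
    (hm : 2 ≤ m k ∨ 3 ≤ ENat.card F ∨ 2 ≤ m j) : X j = 0 := by
  classical
  have hIm : ∀ j, Nat.card (I j) ≤ m j := fun j => by
    simpa using (Finset.card_le_univ (I j)).trans (by simpa using hnm j)
  suffices hrow : ∀ c ∉ I j, row T j c X = 0 by
    refine apply_eq_zero_of_rows (T := T) fun c => ?_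
    by_cases hc : c ∈ I j
    · exact hX0 j hjk ⟨c, hc⟩
    · exact hrow c hc
  intro c hc
  have hjn : (I j).card < n j := by
    simpa using Finset.card_lt_univ_of_notMem hc
  by_cases hk : 2 ≤ m k ∨ 3 ≤ ENat.card F
  · -- the contribution of a single chosen row of block `k` vanishes
    have hone : ∀ (l : I k) (v : Fin (m k) → F), ∀ Z ∈ A,
        (∀ i (l' : I i), row T i l' Z = (Pi.single k (Pi.single l v) :
          (i : Fin t) → I i → Fin (m i) → F) i l') → row T j c Z = 0 := by
      intro l v Z hZA hZ
      obtain ⟨w, hw, hw'⟩ := exists_linearIndependent_add_single (hIm k) hk l v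
      refine eq_zero_of_forall_mem_span (κ := I j)
        (by simpa using hjn.trans_le (hnm j)) fun y hy => ?_
      have hy₀ : ∀ i, ∃ y₀ : I i → Fin (m i) → F, LinearIndependent F y₀ :=
        fun i => exists_linearIndependent_fin (hIm i)
      choose y₀ hy₀ using hy₀
      obtain ⟨W, hWA, hW⟩ := h.exists_rows_eq (Function.update (Function.update y₀ j y) k w)
      have hWk : (fun i : I k => row T k i W) = w := funext fun i => by simp [hW]
      have hWj : (fun i : I j => row T j i W) = y := funext fun i => by simp [hW, hjk]
      have hZj : ∀ i : I j, row T j i Z = 0 := fun i => by simp [hZ, hjk]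
      have h1 := h.row_mem_span hWA (fun i => by
        by_cases hik : i = k
        · subst hik; rwa [hWk]
        by_cases hij : i = j
        · subst hij; rwa [hWj]
        · simpa [hW, hik, hij] using hy₀ i) j c
      have h2 := h.row_mem_span (A.add_mem hWA hZA) (fun i => by
        by_cases hik : i = k
        · subst hik
          convert hw' using 1
          funext l'
          simp [hZ, ← hWk]
        by_cases hij : i = j
        · subst hij
          convert hy using 1
          funext l'
          simp [hZj, ← hWj]
        · simpa [hW, hZ, hik, hij] using hy₀ i) j c
      have hrows : (fun i : I j => row T j i (W + Z)) = y := by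
        funext i
        simp [hZj, ← hWj]
      rw [hWj] at h1
      rw [hrows] at h2
      have h3 := Submodule.sub_mem _ h2 h1
      simpa using h3
    have hZ : ∀ l : I k, ∃ Z ∈ A, ∀ i (l' : I i), row T i l' Z =
        (Pi.single k (Pi.single l (row T k l X)) : (i : Fin t) → I i → Fin (m i) → F) i l' :=
      fun l => h.exists_rows_eq _
    choose Z hZA hZ using hZ
    have hsum : X = ∑ l, Z l := by
      refine h.eq_of_rows_eq hX (A.sum_mem fun l _ => hZA l) fun i l' => ?_
      rw [map_sum]
      simp only [hZ]
      by_cases hik : i = k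
      · subst hik
        simp [Finset.sum_pi_single]
      · simp [hik, hX0 i hik]
    rw [hsum, map_sum]
    refine Finset.sum_eq_zero fun l _ => ?_
    exact hone l _ (Z l) (hZA l) (hZ l)
  · -- block `j` is wider than block `k` and not used up, so block `k` has no chosen rows
    push Not at hk
    have hk' : I k = ∅ := h.eq_empty j k
      (by rcases hm with hm | hm | hm <;> first | omega | exact absurd hm (not_le.2 hk.2)) hjn
    have : X = 0 := h.eq_of_rows_eq hX A.zero_mem fun i l => by
      by_cases hik : i = k
      · subst hik
        exact absurd l.2 (by simp [hk'])
      · simp [hX0 i hik l]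
    simp [this]

/-- If the chosen rows of block `k` vanish, then so does this block: those of the other blocks do not
contribute to it. -/
lemma apply_eq_zero_of_rows_eq_zero (h : IsFrame A T I) (hnm : ∀ j, n j ≤ m j) {X : Space F n m}
    (hX : X ∈ A) {k : Fin t} (hX0 : ∀ l : I k, row T k l X = 0)
    (hm : 2 ≤ m k ∨ 3 ≤ ENat.card F) : X k = 0 := by
  classical
  have hZ : ∀ j, ∃ Z ∈ A, ∀ i (l' : I i), row T i l' Z =
      (Pi.single j (fun l : I j => row T j l X) : (i : Fin t) → I i → Fin (m i) → F) i l' :=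
    fun j => h.exists_rows_eq _
  choose Z hZA hZ using hZ
  have hsum : X = ∑ j, Z j := by
    refine h.eq_of_rows_eq hX (A.sum_mem fun l _ => hZA l) fun i l' => ?_
    rw [map_sum, Finset.sum_eq_single_of_mem i (Finset.mem_univ i)]
    · simp [hZ]
    · intro j _ hji
      simp [hZ, hji.symm]
  rw [hsum, Finset.sum_apply]
  refine Finset.sum_eq_zero fun j _ => ?_
  by_cases hjk : j = k
  · subst hjk
    have : Z j = 0 := h.eq_of_rows_eq (hZA j) A.zero_mem fun i l => by
      by_cases hij : i = j
      · subst hij; simp [hZ, hX0]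
      · simp [hZ, hij]
    simp [this]
  · exact h.apply_eq_zero_of_ne hnm (hZA j) (Ne.symm hjk) (fun i hi l => by simp [hZ, hi])
      (by tauto)

/-- A block of width at least two splits off, and every block does if the field has at least three
elements. -/
lemma single_mem (h : IsFrame A T I) (hnm : ∀ j, n j ≤ m j) {X : Space F n m} (hX : X ∈ A)
    {k : Fin t} (hm : 2 ≤ m k ∨ 3 ≤ ENat.card F) : Pi.single k (X k) ∈ A := by
  obtain ⟨Z, hZA, hZ⟩ := h.exists_rows_eq
    (Pi.single k (fun l : I k => row T k l X) : (i : Fin t) → I i → Fin (m i) → F)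
  have hk : (X - Z) k = 0 := h.apply_eq_zero_of_rows_eq_zero hnm (A.sub_mem hX hZA)
    (fun l => by simp [hZ]) hm
  convert hZA using 1
  funext j
  by_cases hjk : j = k
  · subst hjk
    simpa using sub_eq_zero.1 hk
  · rw [h.apply_eq_zero_of_ne hnm hZA hjk (fun i hi l => by simp [hZ, hi]) (by tauto)]
    simp [hjk]

/-- If the blocks in `D` split off from `A`, then the sum-rank in these blocks is at most the number
of rows that are chosen in them: the other blocks can be made to have at least the rank that the
number of their chosen rows indicates. -/
lemma sum_rank_le (h : IsFrame A T I) (hnm : ∀ j, n j ≤ m j) (D : Finset (Fin t))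
    (hD : ∀ Y ∈ A, ∀ W ∈ A, (fun j => if j ∈ D then Y j else W j : Space F n m) ∈ A)
    {Y : Space F n m} (hY : Y ∈ A) : ∑ j ∈ D, (Y j).rank ≤ ∑ j ∈ D, (I j).card := by
  classical
  have hy₀ : ∀ i, ∃ y₀ : I i → Fin (m i) → F, LinearIndependent F y₀ :=
    fun i => exists_linearIndependent_fin (by
      simpa using (Finset.card_le_univ (I i)).trans (by simpa using hnm i))
  choose y₀ hy₀ using hy₀
  obtain ⟨W, hWA, hW⟩ := h.exists_rows_eq y₀
  have hrank : ∀ j, (I j).card ≤ (W j).rank := fun j =>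
    h.card_le_rank (by simpa only [hW] using hy₀ j)
  have hsrk := h.srk_le _ (hD Y hY W hWA)
  rw [srk, ← Finset.sum_add_sum_compl D, ← Finset.sum_add_sum_compl D fun j => (I j).card] at hsrk
  have h1 : ∑ j ∈ D, (if j ∈ D then Y j else W j).rank = ∑ j ∈ D, (Y j).rank :=
    Finset.sum_congr rfl fun j hj => by rw [if_pos hj]
  have h2 : ∑ j ∈ Dᶜ, (if j ∈ D then Y j else W j).rank = ∑ j ∈ Dᶜ, (W j).rank :=
    Finset.sum_congr rfl fun j hj => by rw [if_neg (Finset.mem_compl.1 hj)]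
  have h3 : ∑ j ∈ Dᶜ, (I j).card ≤ ∑ j ∈ Dᶜ, (W j).rank :=
    Finset.sum_le_sum fun j _ => hrank j
  omega

/-- The projection of `A` to a block of width at least two is an optimal rank-metric anticode. -/
lemma isOptimalLinearRankAnticode (h : IsFrame A T I) (hnm : ∀ j, n j ≤ m j) {k : Fin t}
    (hk : 2 ≤ m k) : IsOptimalLinearRankAnticode (A.map
      (LinearMap.proj (R := F) (φ := fun j => Matrix (Fin (n j)) (Fin (m j)) F) k)) := by
  classical
  set B := A.map (LinearMap.proj (R := F) (φ := fun j => Matrix (Fin (n j)) (Fin (m j)) F) k)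
    with hB
  have hsingle : ∀ M ∈ B, Pi.single k M ∈ A := by
    rintro _ ⟨X, hX, rfl⟩
    exact h.single_mem hnm hX (.inl hk)
  refine ⟨(I k).card, by simpa using Finset.card_le_univ (I k), fun X hX Y hY => ?_, ?_⟩
  · have hmem := hsingle _ (B.sub_mem hX hY)
    simpa using h.sum_rank_le hnm {k} (fun Y hY W hW => by
      convert A.add_mem hW (h.single_mem hnm (A.sub_mem hY hW) (.inl hk)) using 1
      funext j
      by_cases hjk : j = k
      · subst hjk; simp
      · simp [hjk]) hmem
  · let f : B →ₗ[F] I k → Fin (m k) → F := LinearMap.pi fun i => row T k i.1 ∘ₗ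
      LinearMap.single F (fun j => Matrix (Fin (n j)) (Fin (m j)) F) k ∘ₗ B.subtype
    have hf : Function.Bijective f := by
      constructor
      · rw [injective_iff_map_eq_zero]
        intro M hM
        have h0 : (Pi.single k M.1 : Space F n m) = 0 :=
          h.eq_of_rows_eq (hsingle _ M.2) A.zero_mem fun j i => by
            by_cases hjk : j = k
            · subst hjk
              rw [map_zero]
              exact congrFun hM i
            · rw [map_zero, row_eq_zero (by simp [hjk])]
        exact Subtype.ext (by simpa using congrFun h0 k)
      · intro y
        obtain ⟨X, hX, hXy⟩ := h.exists_rows_eq (Pi.single k y)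
        refine ⟨⟨X k, X, hX, rfl⟩, funext fun i => ?_⟩
        exact (row_congr (by simp) i.1).trans ((hXy k i).trans (by simp))
    rw [(LinearEquiv.ofBijective f hf).finrank_eq, Module.finrank_pi_fintype]
    simp [mul_comm]

end IsFrame

end Splitting

/-! ### The blocks of size one by one -/

section Tail

variable {F : Type*} [Field F] {t : ℕ} {n m : Fin t → ℕ} {A : Submodule F (Space F n m)}
  {T : (j : Fin t) → Matrix (Fin (n j)) (Fin (m j)) F ≃ₗ[F] Matrix (Fin (n j)) (Fin (m j)) F}
  {I : (j : Fin t) → Finset (Fin (n j))} {s : ℕ}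

lemma tailIdx_injective : Function.Injective (tailIdx : Fin (t - s) → Fin t) := fun a b h => by
  simpa [tailIdx, Fin.ext_iff] using h

lemma exists_tailIdx_eq {k : Fin t} (hk : s ≤ k.1) : ∃ j : Fin (t - s), tailIdx j = k :=
  ⟨⟨k.1 - s, by omega⟩, Fin.ext (by simp [tailIdx]; omega)⟩

lemma le_tailIdx (j : Fin (t - s)) : s ≤ (tailIdx j).1 := by simp [tailIdx]

/-- `tailVec` as a linear map. -/
def tailLinearMap (hn : ∀ i, 0 < n i) (hm : ∀ i, 0 < m i) (s : ℕ) :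
    Space F n m →ₗ[F] Fin (t - s) → F :=
  LinearMap.pi fun j =>
    LinearMap.proj (R := F) (φ := fun _ => F) (⟨0, hm _⟩ : Fin (m (tailIdx j))) ∘ₗ
    LinearMap.proj (R := F) (φ := fun _ => Fin (m (tailIdx j)) → F)
      (⟨0, hn _⟩ : Fin (n (tailIdx j))) ∘ₗ
    LinearMap.proj (R := F) (φ := fun j => Matrix (Fin (n j)) (Fin (m j)) F) (tailIdx j)

lemma tailLinearMap_apply (hn : ∀ i, 0 < n i) (hm : ∀ i, 0 < m i) (X : Space F n m) :
    tailLinearMap hn hm s X = tailVec hn hm s X := rfl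

/-- A block of size `1 × 1` is determined by its entry in `tailVec`. -/
lemma apply_tailIdx_eq {R : Type*} (hn : ∀ i, 0 < n i) (hm : ∀ i, 0 < m i) (hnm : ∀ i, n i ≤ m i)
    (hs1 : ∀ i : Fin t, s ≤ i.1 → m i = 1) (X : Space R n m) (j : Fin (t - s)) :
    X (tailIdx j) = Matrix.of fun _ _ => tailVec hn hm s X j := by
  have hmj := hs1 _ (le_tailIdx j)
  have hnj := hnm (tailIdx j)
  ext a b
  have ha : a = ⟨0, hn _⟩ := Fin.ext (by have := a.2; simp only; omega)
  have hb : b = ⟨0, hm _⟩ := Fin.ext (by have := b.2; simp only; omega)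
  subst ha hb
  rfl

lemma apply_eq_zero_of_tailVec (hn : ∀ i, 0 < n i) (hm : ∀ i, 0 < m i) (hnm : ∀ i, n i ≤ m i)
    (hs1 : ∀ i : Fin t, s ≤ i.1 → m i = 1) {X : Space F n m} (hX : tailVec hn hm s X = 0)
    {k : Fin t} (hk : s ≤ k.1) : X k = 0 := by
  obtain ⟨j, rfl⟩ := exists_tailIdx_eq hk
  rw [apply_tailIdx_eq hn hm hnm hs1 X j, hX]
  rfl

namespace IsFrame

lemma sum_single_mem (h : IsFrame A T I) (hnm : ∀ i, n i ≤ m i)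
    (hs2 : ∀ i : Fin t, i.1 < s → 2 ≤ m i) {X : Space F n m}
    (hX : ∀ k : Fin t, k.1 < s → ∃ Y ∈ A, Y k = X k) (hX0 : ∀ k : Fin t, s ≤ k.1 → X k = 0) :
    X ∈ A := by
  rw [← Finset.univ_sum_single X]
  refine A.sum_mem fun k _ => ?_
  rcases lt_or_ge k.1 s with hk | hk
  · obtain ⟨Y, hY, hYX⟩ := hX k hk
    exact hYX ▸ h.single_mem hnm hY (.inl (hs2 k hk))
  · simp [hX0 k hk]

/-- Elements of `A` can be recombined freely from a head, made of blocks of width at least two, and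
a tail. -/
lemma recombine_mem (h : IsFrame A T I) (hnm : ∀ i, n i ≤ m i)
    (hs2 : ∀ i : Fin t, i.1 < s → 2 ≤ m i) {X Y : Space F n m}
    (hX : ∀ k : Fin t, k.1 < s → ∃ Z ∈ A, Z k = X k) (hY : Y ∈ A)
    (hXY : ∀ k : Fin t, s ≤ k.1 → X k = Y k) : X ∈ A := by
  have : X - Y ∈ A := h.sum_single_mem hnm hs2
    (fun k hk => by
      obtain ⟨Z, hZ, hZX⟩ := hX k hk
      exact ⟨Z - Y, A.sub_mem hZ hY, by simp [hZX]⟩)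
    fun k hk => by simp [hXY k hk]
  simpa using A.add_mem this hY

/-- The tail of `A`, made of blocks of size `1 × 1`, is an optimal Hamming-metric anticode. -/
lemma isOptimalLinearHammingAnticode (h : IsFrame A T I) (hn : ∀ i, 0 < n i) (hm : ∀ i, 0 < m i)
    (hnm : ∀ i, n i ≤ m i) (hs1 : ∀ i : Fin t, s ≤ i.1 → m i = 1)
    (hs2 : ∀ i : Fin t, i.1 < s → 2 ≤ m i) :
    IsOptimalLinearHammingAnticode (A.map (tailLinearMap hn hm s)) := by
  classical
  set H := A.map (tailLinearMap hn hm s) with hH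
  refine ⟨∑ j : Fin (t - s), (I (tailIdx j)).card, ?_, fun x hx y hy => ?_, ?_⟩
  · have : ∀ j : Fin (t - s), (I (tailIdx j)).card ≤ 1 := fun j => by
      have h1 := hs1 _ (le_tailIdx j)
      have h2 := hnm (tailIdx j)
      have h3 := Finset.card_le_univ (I (tailIdx j))
      rw [Fintype.card_fin] at h3
      omega
    simpa using Finset.sum_le_sum fun j (_ : j ∈ Finset.univ) => this j
  · obtain ⟨Y, hY, hYxy⟩ := H.sub_mem hx hy
    have hD := h.sum_rank_le hnm (Finset.univ.map ⟨tailIdx (t := t) (s := s), tailIdx_injective⟩)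
      (fun Y hY W hW => h.recombine_mem hnm hs2 (Y := Y)
        (fun k hk => ⟨W, hW, by
          rw [if_neg]
          simp only [Finset.mem_map, Finset.mem_univ, true_and, Function.Embedding.coeFn_mk]
          rintro ⟨j, rfl⟩
          exact (le_tailIdx j).not_gt hk⟩) hY
        fun k hk => if_pos (by
          obtain ⟨j, rfl⟩ := exists_tailIdx_eq hk
          simp)) hY
    rw [Finset.sum_map, Finset.sum_map] at hD
    refine le_trans ?_ hD
    rw [hammingDist, Finset.card_filter]
    refine Finset.sum_le_sum fun j _ => ?_
    split_ifs with hj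
    · refine (Fintype.card_unit.symm.le.trans (card_le_rank_of_linearIndependent (κ := Unit)
        (M := Y (tailIdx j)) (f := fun _ => ⟨0, hn _⟩)
        (LinearIndependent.of_subsingleton () fun h0 => hj ?_)))
      have : tailLinearMap hn hm s Y j = 0 := congrFun h0 ⟨0, hm _⟩
      rw [hYxy] at this
      exact sub_eq_zero.1 this
    · exact Nat.zero_le _
  · -- the chosen rows of the tail are coordinates on it
    let c : (k : Fin t) → F →ₗ[F] Matrix (Fin (n k)) (Fin (m k)) F := fun k =>
      { toFun := fun a => Matrix.of fun _ _ => a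
        map_add' := fun _ _ => rfl
        map_smul' := fun _ _ => rfl }
    let f : H →ₗ[F] (j : Fin (t - s)) → I (tailIdx j) → Fin (m (tailIdx j)) → F :=
      LinearMap.pi fun j => LinearMap.pi fun i => row T (tailIdx j) i.1 ∘ₗ
        LinearMap.single F (fun k => Matrix (Fin (n k)) (Fin (m k)) F) (tailIdx j) ∘ₗ
        c (tailIdx j) ∘ₗ LinearMap.proj (R := F) (φ := fun _ => F) j ∘ₗ H.subtype
    have hfX : ∀ (X : Space F n m) (hX : tailLinearMap hn hm s X ∈ H) j i,
        f ⟨tailLinearMap hn hm s X, hX⟩ j i = row T (tailIdx j) i.1 X := fun X hX j i => by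
      refine row_congr ?_ i.1
      refine (Pi.single_eq_same _ _).trans ?_
      exact (apply_tailIdx_eq hn hm hnm hs1 X j).symm
    have hf : Function.Bijective f := by
      constructor
      · rw [injective_iff_map_eq_zero]
        rintro ⟨_, X, hX, rfl⟩ hX0
        -- remove the head of `X`
        have hX' : (fun k => if k.1 < s then 0 else X k : Space F n m) ∈ A :=
          h.recombine_mem hnm hs2 (Y := X) (fun k hk => ⟨0, A.zero_mem, by simp [hk]⟩) hX
            fun k hk => by simp [hk.not_gt]
        have h0 := h.eq_of_rows_eq hX' A.zero_mem fun k i => by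
          rw [map_zero]
          rcases lt_or_ge k.1 s with hk | hk
          · exact row_eq_zero (by simp [hk]) _
          · obtain ⟨j, rfl⟩ := exists_tailIdx_eq hk
            rw [row_congr (Y := X) (by simp [hk.not_gt]), ← hfX X ⟨X, hX, rfl⟩, hX0]
            rfl
        refine Subtype.ext (funext fun j => ?_)
        have hXj := congrFun h0 (tailIdx j)
        simp only [(le_tailIdx j).not_gt, if_false] at hXj
        change X (tailIdx j) _ _ = 0
        rw [hXj]
        rfl
      · intro z
        obtain ⟨X, hX, hXz⟩ := h.exists_rows_eq (∑ j, Pi.single (tailIdx j) (z j))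
        refine ⟨⟨tailLinearMap hn hm s X, X, hX, rfl⟩, funext fun j => funext fun i => ?_⟩
        refine (hfX X ⟨X, hX, rfl⟩ j i).trans ?_
        rw [hXz, Finset.sum_apply, Finset.sum_eq_single_of_mem j (Finset.mem_univ j)]
        · simp
        · intro j' _ hj'
          exact Pi.single_eq_of_ne (fun h => hj' (tailIdx_injective h).symm) _
    rw [(LinearEquiv.ofBijective f hf).finrank_eq, Module.finrank_pi_fintype]
    refine Finset.sum_congr rfl fun j _ => ?_
    rw [Module.finrank_pi_fintype]
    simp [hs1 _ (le_tailIdx j)]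

/-- If every block splits off, the tail is spanned by coordinate vectors. -/
lemma exists_tail_eq_pi (h : IsFrame A T I) (hn : ∀ i, 0 < n i) (hm : ∀ i, 0 < m i)
    (hnm : ∀ i, n i ≤ m i) (hF : 3 ≤ ENat.card F) :
    ∃ C : Fin (t - s) → Submodule F F, (∀ j, C j = ⊤ ∨ C j = ⊥) ∧
      A.map (tailLinearMap hn hm s) = Submodule.pi Set.univ C := by
  classical
  set H := A.map (tailLinearMap hn hm s) with hH
  refine ⟨fun j => H.map (LinearMap.proj j), fun j => (eq_bot_or_eq_top _).symm, le_antisymm ?_ ?_⟩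
  · exact fun x hx j _ => ⟨x, hx, rfl⟩
  · intro x hx
    rw [← Finset.univ_sum_single x]
    refine H.sum_mem fun j _ => ?_
    obtain ⟨_, ⟨Y, hY, rfl⟩, hYx⟩ := hx j (Set.mem_univ j)
    refine ⟨_, h.single_mem hnm hY (k := tailIdx j) (.inr hF), ?_⟩
    funext j'
    rw [tailLinearMap_apply, tailVec, ← hYx]
    by_cases hj : j' = j
    · subst hj
      simp
      rfl
    · rw [Pi.single_eq_of_ne (fun h => hj (tailIdx_injective h)), Pi.single_eq_of_ne hj]
      rfl

end IsFrame

end Tail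

end SumRank

theorem theorem3p1 {F : Type*} [Field F] (t : ℕ) (n m : Fin t → ℕ)
    (hn : ∀ i, 0 < n i) (hm : ∀ i, 0 < m i) (hnm : ∀ i, n i ≤ m i) (hmono : Antitone m)
    (s : ℕ) (hs : s ≤ t) (hsm : ∀ i : Fin t, 1 < m i ↔ i.1 < s)
    (A : Submodule F (SumRank.Space F n m)) (hA : SumRank.IsOptimalLinearAnticode A) :
    ∃ (B : (i : Fin s) →
          Submodule F (Matrix (Fin (n (SumRank.headIdx hs i))) (Fin (m (SumRank.headIdx hs i))) F))
      (H : Submodule F (Fin (t - s) → F)),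
      (∀ X : SumRank.Space F n m,
        X ∈ A ↔ (∀ i : Fin s, X (SumRank.headIdx hs i) ∈ B i) ∧ SumRank.tailVec hn hm s X ∈ H) ∧
      (∀ i : Fin s, SumRank.IsOptimalLinearRankAnticode (B i)) ∧
      SumRank.IsOptimalLinearHammingAnticode H ∧
      (3 ≤ ENat.card F →
        ∃ C : Fin (t - s) → Submodule F F,
          (∀ j, C j = ⊤ ∨ C j = ⊥) ∧ H = Submodule.pi Set.univ C) := by
  obtain ⟨T, I, h⟩ := SumRank.exists_isFrame hm hnm hA
  have hs2 : ∀ i : Fin t, i.1 < s → 2 ≤ m i := fun i hi => (hsm i).2 hi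
  have hs1 : ∀ i : Fin t, s ≤ i.1 → m i = 1 := fun i hi => by
    have h1 := hm i
    have h2 := mt (hsm i).1 hi.not_gt
    omega
  refine ⟨fun i => A.map (LinearMap.proj (R := F)
      (φ := fun j => Matrix (Fin (n j)) (Fin (m j)) F) (SumRank.headIdx hs i)),
    A.map (SumRank.tailLinearMap hn hm s), fun X => ⟨fun hX => ?_, ?_⟩,
    fun i => h.isOptimalLinearRankAnticode hnm (hs2 _ i.2),
    h.isOptimalLinearHammingAnticode hn hm hnm hs1 hs2,
    fun hF => h.exists_tail_eq_pi hn hm hnm hF⟩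
  · exact ⟨fun i => ⟨X, hX, rfl⟩, X, hX, rfl⟩
  · rintro ⟨hhead, Y, hY, hYX⟩
    refine h.recombine_mem hnm hs2 (fun k hk => ?_) hY fun k hk => ?_
    · obtain ⟨Z, hZ, hZX⟩ := hhead ⟨k.1, hk⟩
      exact ⟨Z, hZ, hZX⟩
    · refine sub_eq_zero.1 (SumRank.apply_eq_zero_of_tailVec hn hm hnm hs1 (X := X - Y) ?_ hk)
      rw [← SumRank.tailLinearMap_apply, map_sub, hYX, SumRank.tailLinearMap_apply, sub_self]
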